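/- All graphs are finite and simple. A cut vertex of a graph is a vertex that separates two other vertices of the same component. A block of a graph is a maximal connected subgraph that has no cut vertex of its own (an isolated vertex is a block). For a graph $H$, let $B(H)$ be the intersection graph of the blocks of $H$; a block graph is a graph isomorphic to $B(H)$ for some graph $H$. The weighted block tree $\mathrm{bcw}(G)$ of a connected graph $G$ has as vertices the cut vertices and the blocks of $G$, a cut vertex being adjacent to exactly the blocks that contain it; each cut vertex has weight $1$ and each block has as weight its number of vertices that are not cut vertices of $G$. A weighted block tree is a weighted tree $(T,w)$ that is isomorphic, by a bijection preserving adjacency and weights, to $\mathrm{bcw}(H)$ for some connected graph $H$. Call a vertex of a tree a leaf if its degree is at most $1$, and a block vertex if it is at even distance from some leaf. Theorem. For every $n\ge 0$ the map $G\mapsto \mathrm{bcw}(G)$ induces a bijection from the isomorphism classes of connected block graphs on $n$ vertices to the isomorphism classes of weighted block trees of total weight $n$. The inverse sends $(T,w)$ to the graph obtained as follows: for each block vertex $B$ of $T$ take a clique on $w(B)+\deg_T(B)$ vertices, the cliques being disjoint, and choose in it distinct vertices, one for each neighbour of $B$ in $T$; then, for every vertex $v$ of $T$ that is not a block vertex,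 identify all the vertices chosen for $v$. Up to isomorphism the result does not depend on the choices. Moreover, a pair $(T,w)$ of a graph $T$ and a function $w:V(T)\to\mathbb{Z}_{\ge 0}$ is a weighted block tree if and only if $T$ is a tree, any two leaves of $T$ are at even distance, every vertex that is not a block vertex has weight $1$, and every leaf has weight at least $1$. -/

import Mathlib

namespace BlockGraphs

/-- `v` is a cut vertex of `G`: it separates two other vertices of one connected component. -/
def IsCutVertex {V : Type*} (G : SimpleGraph V) (v : V) : Prop :=
  ∃ x y : V, x ≠ v ∧ y ≠ v ∧ G.Reachable x y ∧ ∀ p : G.Walk x y, v ∈ p.support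

/-- The subgraph induced by `S` is connected (in particular nonempty) and has no cut vertex of
its own. -/
def IsNonseparable {V : Type*} (G : SimpleGraph V) (S : Set V) : Prop :=
  (G.induce S).Connected ∧ ∀ v : S, ¬ IsCutVertex (G.induce S) v

/-- A block is a maximal connected subgraph without a cut vertex. Such a subgraph is induced, so
it is given by its vertex set. The only block of a one-vertex component is the component. -/
def IsBlock {V : Type*} (G : SimpleGraph V) (S : Set V) : Prop :=
  Maximal (IsNonseparable G) S

/-- The graph `B(H)`: the intersection graph of the blocks of `H`. -/
def blockIntersectionGraph {V : Type*} (H : SimpleGraph V) :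
    SimpleGraph {S : Set V // IsBlock H S} where
  Adj A B := A ≠ B ∧ (A.1 ∩ B.1).Nonempty
  symm := ⟨fun A B h => ⟨h.1.symm, Set.inter_comm A.1 B.1 ▸ h.2⟩⟩
  loopless := ⟨fun _ h => h.1 rfl⟩

/-- `G` is a block graph: it is isomorphic to `B(H)` for some finite graph `H`. -/
def IsBlockGraph {V : Type*} (G : SimpleGraph V) : Prop :=
  ∃ (k : ℕ) (H : SimpleGraph (Fin k)), Nonempty (G ≃g blockIntersectionGraph H)

/-- The vertices of the block tree of `G`: the cut vertices and the blocks of `G`. -/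
abbrev BlockTreeVertex {V : Type*} (G : SimpleGraph V) : Type _ :=
  {v : V // IsCutVertex G v} ⊕ {S : Set V // IsBlock G S}

/-- The block tree of `G`: a cut vertex is adjacent to exactly the blocks that contain it. -/
def blockTree {V : Type*} (G : SimpleGraph V) : SimpleGraph (BlockTreeVertex G) where
  Adj
    | Sum.inl v, Sum.inr B => v.1 ∈ B.1
    | Sum.inr B, Sum.inl v => v.1 ∈ B.1
    | _, _ => False
  symm := ⟨by rintro (a | a) (b | b) h <;> exact h⟩
  loopless := ⟨by rintro (a | a) h <;> exact h⟩

/-- Cut vertices have weight `1`; the weight of a block is its number of non-cut vertices. -/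
noncomputable def blockTreeWeight {V : Type*} (G : SimpleGraph V) : BlockTreeVertex G → ℕ
  | Sum.inl _ => 1
  | Sum.inr B => {v : V | v ∈ B.1 ∧ ¬ IsCutVertex G v}.ncard

/-- Isomorphism of vertex-weighted graphs. -/
def WeightedIso {V W : Type*} (T : SimpleGraph V) (w : V → ℕ) (T' : SimpleGraph W) (w' : W → ℕ) :
    Prop :=
  ∃ f : T ≃g T', ∀ v, w' (f v) = w v

/-- `(T, w)` is a weighted block tree: a tree that is, as a weighted graph, the weighted block tree
of some finite connected graph (which need not be a block graph). -/
def IsWeightedBlockTree {V : Type*} (T : SimpleGraph V) (w : V → ℕ) : Prop :=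
  T.IsTree ∧ ∃ (k : ℕ) (H : SimpleGraph (Fin k)), H.Connected ∧
    WeightedIso (blockTree H) (blockTreeWeight H) T w

/-- Vertices of degree at most one; the vertex of a one-vertex tree counts as a leaf. -/
def IsLeaf {V : Type*} (T : SimpleGraph V) (v : V) : Prop :=
  (T.neighborSet v).Subsingleton

/-- The vertices of a tree that must correspond to blocks: those at even distance from a leaf. -/
def IsBlockVertex {V : Type*} (T : SimpleGraph V) (v : V) : Prop :=
  ∃ l : V, IsLeaf T l ∧ Even (T.dist v l)

/-- The cliques, before gluing, built from `(T, w)`: one on `w(B) + deg(B)` vertices for each block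
vertex `B`. -/
abbrev CliqueVertex {V : Type*} (T : SimpleGraph V) (w : V → ℕ) : Type _ :=
  Σ B : {B : V // IsBlockVertex T B}, Fin (w B.1 + (T.neighborSet B.1).ncard)

/-- For each block vertex `B`, a choice of distinct vertices of the clique of `B`, one for each
neighbour of `B` in `T`. -/
abbrev GluingChoice {V : Type*} (T : SimpleGraph V) (w : V → ℕ) : Type _ :=
  ∀ B : {B : V // IsBlockVertex T B},
    T.neighborSet B.1 ↪ Fin (w B.1 + (T.neighborSet B.1).ncard)

/-- Two clique vertices are identified if they were chosen for the same vertex `v` of `T`. -/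
def Glued {V : Type*} {T : SimpleGraph V} {w : V → ℕ} (e : GluingChoice T w)
    (x y : CliqueVertex T w) : Prop :=
  ∃ (v : V) (hx : T.Adj x.1.1 v) (hy : T.Adj y.1.1 v),
    x.2 = e x.1 ⟨v, hx⟩ ∧ y.2 = e y.1 ⟨v, hy⟩

/-- The graph obtained from the disjoint cliques by performing the identifications. -/
def gluedGraph {V : Type*} {T : SimpleGraph V} {w : V → ℕ} (e : GluingChoice T w) :
    SimpleGraph (Quot (Glued e)) where
  Adj x y := x ≠ y ∧ ∃ (B : {B : V // IsBlockVertex T B})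
    (i j : Fin (w B.1 + (T.neighborSet B.1).ncard)),
      x = Quot.mk (Glued e) ⟨B, i⟩ ∧ y = Quot.mk (Glued e) ⟨B, j⟩
  symm := ⟨fun _ _ ⟨h, B, i, j, hi, hj⟩ => ⟨h.symm, B, j, i, hj, hi⟩⟩
  loopless := ⟨fun _ h => h.1 rfl⟩

/-- Connected block graphs on the vertex set `Fin n`. -/
structure ConnectedBlockGraph (n : ℕ) where
  graph : SimpleGraph (Fin n)
  connected : graph.Connected
  isBlockGraph : IsBlockGraph graph

/-- Weighted block trees of total weight `n`, on a vertex set `Fin m` for any `m`. -/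
structure WeightedBlockTree (n : ℕ) where
  m : ℕ
  tree : SimpleGraph (Fin m)
  weight : Fin m → ℕ
  isWeightedBlockTree : IsWeightedBlockTree tree weight
  total : ∑ v, weight v = n

instance ConnectedBlockGraph.setoid (n : ℕ) : Setoid (ConnectedBlockGraph n) where
  r G G' := Nonempty (G.graph ≃g G'.graph)
  iseqv := ⟨fun _ => ⟨SimpleGraph.Iso.refl⟩, fun ⟨f⟩ => ⟨f.symm⟩, fun ⟨f⟩ ⟨g⟩ => ⟨f.trans g⟩⟩

instance WeightedBlockTree.setoid (n : ℕ) : Setoid (WeightedBlockTree n) where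
  r T T' := WeightedIso T.tree T.weight T'.tree T'.weight
  iseqv := ⟨fun _ => ⟨SimpleGraph.Iso.refl, fun _ => rfl⟩,
    fun ⟨f, hf⟩ => ⟨f.symm, fun v => by rw [← hf (f.symm v), f.apply_symm_apply]⟩,
    fun ⟨f, hf⟩ ⟨g, hg⟩ => ⟨f.trans g, fun v => by
      rw [← hf v, ← hg (f v)]; rfl⟩⟩

/-- Isomorphism classes of connected block graphs on `n` vertices. -/
abbrev ConnectedBlockGraphClass (n : ℕ) : Type :=
  Quotient (ConnectedBlockGraph.setoid n)

/-- Isomorphism classes of weighted block trees of total weight `n`. -/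
abbrev WeightedBlockTreeClass (n : ℕ) : Type :=
  Quotient (WeightedBlockTree.setoid n)

end BlockGraphs

namespace BlockGraphs

/-! Everything passes through one relation, `Represents G T w t`: `t` maps the vertices of `G` to
those of `T` with fibres of size `w`, and `G` is the union of the cliques on the bags, the parts of
`G` over a block vertex and its neighbours. Adjacency is read off from `t`, so `(T, w)` determines
`G` up to isomorphism (`Represents.nonempty_iso`).

If all blocks of a connected graph are cliques, its block tree represents it
(`exists_represents_blockTree`). Conversely, if `(T, w)` satisfies the combinatorial conditions
(`IsAdmissible`), a represented graph is connected, its blocks are the bags, and its block tree is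
`(T, w)` again (`Represents.weightedIso`). So for a connected block graph, having block tree `(T,
w)` means being represented by it: this yields well-definedness and injectivity. An explicit
represented graph yields surjectivity and the characterization of weighted block trees, and the
glued graph is the inverse image because it is represented too.

Two structural facts carry this. Distinct blocks through `v` are separated by `v`, so vertices and
blocks form a forest (`isAcyclic_blockIncidenceGraph`). In a union of cliques with the same
separation property, a nontrivial nonseparable set lies in a single clique
(`IsCliqueTree.exists_subset`); this is applied to `B(H)`, to a graph with prescribed `B`, and to
the bags. -/

/-- `x` and `y` are joined by a walk of `G` that stays in `S`. -/
def ConnIn {V : Type*} (G : SimpleGraph V) (S : Set V) (x y : V) : Prop :=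
  ∃ p : G.Walk x y, ∀ z ∈ p.support, z ∈ S

/-! ### Walks confined to a vertex set. -/

section ConnIn

variable {V W : Type*} {G : SimpleGraph V} {S S' : Set V} {x y z : V}

theorem ConnIn.refl (hx : x ∈ S) : ConnIn G S x x :=
  ⟨.nil, by simpa using hx⟩

theorem ConnIn.symm (h : ConnIn G S x y) : ConnIn G S y x := by
  obtain ⟨p, hp⟩ := h
  exact ⟨p.reverse, by simpa using hp⟩

theorem ConnIn.trans (h : ConnIn G S x y) (h' : ConnIn G S y z) : ConnIn G S x z := by
  obtain ⟨p, hp⟩ := h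
  obtain ⟨q, hq⟩ := h'
  refine ⟨p.append q, fun a ha => ?_⟩
  rw [SimpleGraph.Walk.mem_support_append_iff] at ha
  exact ha.elim (hp a) (hq a)

theorem ConnIn.mono (hS : S ⊆ S') (h : ConnIn G S x y) : ConnIn G S' x y := by
  obtain ⟨p, hp⟩ := h
  exact ⟨p, fun a ha => hS (hp a ha)⟩

theorem ConnIn.of_adj (h : G.Adj x y) (hx : x ∈ S) (hy : y ∈ S) : ConnIn G S x y :=
  ⟨h.toWalk, by simp [hx, hy]⟩

theorem ConnIn.left_mem (h : ConnIn G S x y) : x ∈ S := by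
  obtain ⟨p, hp⟩ := h
  exact hp x p.start_mem_support

theorem ConnIn.right_mem (h : ConnIn G S x y) : y ∈ S :=
  h.symm.left_mem

theorem ConnIn.reachable (h : ConnIn G S x y) : G.Reachable x y :=
  ⟨h.choose⟩

/-- Induction along a walk that stays in `S`. -/
theorem ConnIn.induction_on {P : V → Prop} (h : ConnIn G S x y) (hx : P x)
    (step : ∀ a ∈ S, ∀ b ∈ S, G.Adj a b → P a → P b) : P y := by
  obtain ⟨p, hp⟩ := h
  induction p with
  | nil => exact hx
  | cons hadj p ih =>
    simp only [SimpleGraph.Walk.support_cons, List.mem_cons, forall_eq_or_imp] at hp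
    exact ih (step _ hp.1 _ (hp.2 _ p.start_mem_support) hadj hx) hp.2

/-- A map that sends edges to joined pairs sends joined pairs to joined pairs. -/
theorem ConnIn.map {G' : SimpleGraph W} {R : Set W} {f : V → W} (h : ConnIn G S x y)
    (hx : f x ∈ R)
    (step : ∀ a ∈ S, ∀ b ∈ S, G.Adj a b → f a ∈ R → ConnIn G' R (f a) (f b)) :
    ConnIn G' R (f x) (f y) :=
  h.induction_on (P := fun a => ConnIn G' R (f x) (f a)) (.refl hx)
    fun a ha b hb hab h => h.trans (step a ha b hb hab h.right_mem)

theorem reachable_induce_iff {a b : S} : (G.induce S).Reachable a b ↔ ConnIn G S a b := by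
  constructor
  · rintro ⟨p⟩
    have h : ∀ z ∈ (p.map (SimpleGraph.Embedding.induce S).toHom).support, z ∈ S := by
      intro z hz
      rw [SimpleGraph.Walk.support_map, List.mem_map] at hz
      obtain ⟨c, -, rfl⟩ := hz
      exact c.2
    exact ⟨_, h⟩
  · rintro ⟨p, hp⟩
    exact ⟨p.induce S hp⟩

theorem exists_induce_walk_avoiding_iff {v a b : S} :
    (∃ p : (G.induce S).Walk a b, v ∉ p.support) ↔ ConnIn G (S \ {v.1}) a b := by
  constructor
  · rintro ⟨p, hv⟩
    have h : ∀ z ∈ (p.map (SimpleGraph.Embedding.induce S).toHom).support, z ∈ S \ {v.1} := by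
      intro z hz
      rw [SimpleGraph.Walk.support_map, List.mem_map] at hz
      obtain ⟨c, hc, rfl⟩ := hz
      refine ⟨c.2, fun h => hv ?_⟩
      have : c = v := Subtype.ext h
      rwa [← this]
    exact ⟨_, h⟩
  · rintro ⟨p, hp⟩
    refine ⟨p.induce S fun z hz => (hp z hz).1, fun hv => ?_⟩
    rw [SimpleGraph.Walk.support_induce] at hv
    exact (hp v.1 (by simpa using hv)).2 rfl

end ConnIn

/-! ### Nonseparable sets, blocks and cut vertices. -/

section Nonseparable

variable {V : Type*} {G : SimpleGraph V} {S B B' : Set V} {x y z v : V}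

theorem isCutVertex_iff :
    IsCutVertex G v ↔ ∃ x y, x ≠ v ∧ y ≠ v ∧ G.Reachable x y ∧ ¬ ConnIn G {v}ᶜ x y := by
  unfold IsCutVertex ConnIn
  refine exists₂_congr fun x y => and_congr_right fun _ => and_congr_right fun _ =>
    and_congr_right fun _ => ?_
  push Not
  refine forall_congr' fun p => ?_
  simp

/-- A nonempty set is nonseparable iff it stays connected when at most one vertex is removed. -/
theorem isNonseparable_iff :
    IsNonseparable G S ↔ S.Nonempty ∧
      ∀ D : Set V, D.Subsingleton → ∀ x ∈ S \ D, ∀ y ∈ S \ D, ConnIn G (S \ D) x y := by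
  constructor
  · rintro ⟨hc, hcut⟩
    refine ⟨Set.nonempty_coe_sort.1 hc.nonempty, fun D hD x hx y hy => ?_⟩
    have hconn := reachable_induce_iff.1 (hc.preconnected ⟨x, hx.1⟩ ⟨y, hy.1⟩)
    by_cases hDS : ∃ u ∈ D, u ∈ S
    · obtain ⟨u, huD, huS⟩ := hDS
      obtain rfl : D = {u} := hD.eq_singleton_of_mem huD
      have h := hcut ⟨u, huS⟩
      simp only [IsCutVertex] at h
      push Not at h
      exact exists_induce_walk_avoiding_iff.1 (h ⟨x, hx.1⟩ ⟨y, hy.1⟩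
        (fun e => hx.2 (congrArg Subtype.val e)) (fun e => hy.2 (congrArg Subtype.val e))
        (hc.preconnected _ _))
    · push Not at hDS
      exact hconn.mono fun a ha => ⟨ha, fun h => hDS a h ha⟩
  · rintro ⟨hne, h⟩
    have : Nonempty S := hne.to_subtype
    refine ⟨⟨fun a b => reachable_induce_iff.2 ?_⟩, ?_⟩
    · exact (h ∅ Set.subsingleton_empty a ⟨a.2, id⟩ b ⟨b.2, id⟩).mono Set.sdiff_subset
    · rintro v ⟨a, b, ha, hb, -, hp⟩
      obtain ⟨p, hv⟩ := exists_induce_walk_avoiding_iff.2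
        (h {v.1} Set.subsingleton_singleton a ⟨a.2, fun e => ha (Subtype.ext e)⟩ b
          ⟨b.2, fun e => hb (Subtype.ext e)⟩)
      exact hv (hp p)

theorem IsNonseparable.nonempty (h : IsNonseparable G S) : S.Nonempty :=
  (isNonseparable_iff.1 h).1

theorem IsNonseparable.connIn_diff (h : IsNonseparable G S) {D : Set V} (hD : D.Subsingleton)
    (hx : x ∈ S) (hxD : x ∉ D) (hy : y ∈ S) (hyD : y ∉ D) : ConnIn G (S \ D) x y :=
  (isNonseparable_iff.1 h).2 D hD x ⟨hx, hxD⟩ y ⟨hy, hyD⟩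

theorem IsNonseparable.connIn (h : IsNonseparable G S) (hx : x ∈ S) (hy : y ∈ S) :
    ConnIn G S x y :=
  (h.connIn_diff Set.subsingleton_empty hx id hy id).mono Set.sdiff_subset

theorem IsNonseparable.connIn_compl (h : IsNonseparable G S)
    (hx : x ∈ S) (hxv : x ≠ v) (hy : y ∈ S) (hyv : y ≠ v) : ConnIn G {v}ᶜ x y :=
  (h.connIn_diff Set.subsingleton_singleton hx hxv hy hyv).mono fun _ h => h.2

theorem isNonseparable_of_isClique (hne : S.Nonempty)
    (h : ∀ x ∈ S, ∀ y ∈ S, x ≠ y → G.Adj x y) : IsNonseparable G S := by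
  refine isNonseparable_iff.2 ⟨hne, fun D _ x hx y hy => ?_⟩
  by_cases hxy : x = y
  · subst hxy
    exact .refl hx
  · exact .of_adj (h x hx.1 y hy.1 hxy) hx hy

/-- A vertex of a path can reach one of the ends along the path while avoiding a given other
vertex. -/
theorem connIn_end_of_mem_path {p : G.Walk y z} (hp : p.IsPath) (hx : x ∈ p.support) {D : Set V}
    (hD : D.Subsingleton) (hxD : x ∉ D) :
    ConnIn G ({a | a ∈ p.support} \ D) x y ∨ ConnIn G ({a | a ∈ p.support} \ D) x z := by
  classical
  -- If `D` meets the initial part of the path, its only element lies there, hence not on the final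
  -- part, since the path is simple.
  by_cases h : ∃ d ∈ D, d ∈ (p.takeUntil x hx).support
  · obtain ⟨d, hdD, hd⟩ := h
    right
    refine ⟨p.dropUntil x hx, fun a ha => ⟨p.support_dropUntil_subset_support hx ha, fun haD => ?_⟩⟩
    obtain rfl := hD hdD haD
    have hdx : d ≠ x := fun e => hxD (e ▸ hdD)
    have hp' := hp
    rw [← p.take_spec hx] at hp'
    have hd' : d ∈ (p.dropUntil x hx).support.tail := by
      rw [← SimpleGraph.Walk.cons_tail_support, List.mem_cons] at ha
      exact ha.resolve_left hdx
    have := hp'.support_nodup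
    rw [SimpleGraph.Walk.support_append] at this
    exact List.disjoint_of_nodup_append this hd hd'
  · push Not at h
    left
    exact ConnIn.symm ⟨p.takeUntil x hx, fun a ha =>
      ⟨p.support_takeUntil_subset_support hx ha, fun haD => h a haD ha⟩⟩

/-- Two nonseparable sets with a common vertex `v` that are also joined by a walk avoiding `v` lie
in a common nonseparable set. -/
theorem IsNonseparable.exists_superset (hB : IsNonseparable G B) (hB' : IsNonseparable G B')
    (hv : v ∈ B) (hv' : v ∈ B') (hz : z ∈ B) (hy : y ∈ B') (h : ConnIn G {v}ᶜ z y) :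
    ∃ U, IsNonseparable G U ∧ B ⊆ U ∧ B' ⊆ U := by
  classical
  have hzv : z ≠ v := h.left_mem
  have hyv : y ≠ v := h.right_mem
  obtain ⟨q, hq⟩ := h
  obtain ⟨p, hpath, hpv⟩ : ∃ p : G.Walk z y, p.IsPath ∧ v ∉ p.support :=
    ⟨q.bypass, q.bypass_isPath, fun hvp => hq v (q.support_bypass_subset_support hvp) rfl⟩
  set P : Set V := {a | a ∈ p.support} with hP
  have hBU : B ⊆ B ∪ B' ∪ P := fun a ha => .inl (.inl ha)
  have hB'U : B' ⊆ B ∪ B' ∪ P := fun a ha => .inl (.inr ha)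
  have hPU : P ⊆ B ∪ B' ∪ P := fun a ha => .inr ha
  refine ⟨B ∪ B' ∪ P, isNonseparable_iff.2 ⟨hB.nonempty.mono hBU, fun D hD => ?_⟩, hBU, hB'U⟩
  -- It suffices to reach `B` while avoiding `D`, as `B \ D` is connected. If `D = {v}`, the path
  -- `P` leads from `B'` to `B`; otherwise `B'` reaches `v`, and a vertex of `P` reaches one of its
  -- ends.
  have toB : ∀ x ∈ (B ∪ B' ∪ P) \ D, ∃ b ∈ B, b ∉ D ∧ ConnIn G ((B ∪ B' ∪ P) \ D) x b := by
    by_cases hvD : v ∈ D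
    · obtain rfl : D = {v} := hD.eq_singleton_of_mem hvD
      have hPD : P ⊆ (B ∪ B' ∪ P) \ {v} := fun a ha => ⟨hPU ha, fun e => hpv (e ▸ ha)⟩
      have hyz : ConnIn G ((B ∪ B' ∪ P) \ {v}) y z :=
        ConnIn.symm ⟨p, fun a ha => hPD ha⟩
      rintro x ⟨(hx | hx) | hx, hxD⟩
      · exact ⟨x, hx, hxD, .refl ⟨hBU hx, hxD⟩⟩
      · exact ⟨z, hz, hzv, ((hB'.connIn_diff hD hx hxD hy hyv).mono
          (Set.sdiff_subset_sdiff_left hB'U)).trans hyz⟩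
      · refine ⟨z, hz, hzv, ConnIn.symm ⟨p.takeUntil x hx, fun a ha => hPD ?_⟩⟩
        exact p.support_takeUntil_subset_support hx ha
    · have hB'v : ∀ x ∈ B', x ∉ D → ConnIn G ((B ∪ B' ∪ P) \ D) x v := fun x hx hxD =>
        (hB'.connIn_diff hD hx hxD hv' hvD).mono (Set.sdiff_subset_sdiff_left hB'U)
      rintro x ⟨(hx | hx) | hx, hxD⟩
      · exact ⟨x, hx, hxD, .refl ⟨hBU hx, hxD⟩⟩
      · exact ⟨v, hv, hvD, hB'v x hx hxD⟩
      · rcases connIn_end_of_mem_path hpath hx hD hxD with h | h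
        · exact ⟨z, hz, h.right_mem.2, h.mono (Set.sdiff_subset_sdiff_left hPU)⟩
        · exact ⟨v, hv, hvD, (h.mono (Set.sdiff_subset_sdiff_left hPU)).trans
            (hB'v y hy h.right_mem.2)⟩
  intro x hx x' hx'
  obtain ⟨b, hb, hbD, hxb⟩ := toB x hx
  obtain ⟨b', hb', hbD', hxb'⟩ := toB x' hx'
  exact hxb.trans (((hB.connIn_diff hD hb hbD hb' hbD').mono
    (Set.sdiff_subset_sdiff_left hBU)).trans hxb'.symm)

theorem IsBlock.isNonseparable (h : IsBlock G B) : IsNonseparable G B :=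
  h.prop

theorem IsBlock.nonempty (h : IsBlock G B) : B.Nonempty :=
  h.isNonseparable.nonempty

/-- By maximality both blocks equal the nonseparable set containing them. In other words, distinct
blocks through `v` are separated by `v`. -/
theorem IsBlock.eq_of_connIn (hB : IsBlock G B) (hB' : IsBlock G B') (hv : v ∈ B) (hv' : v ∈ B')
    (hz : z ∈ B) (hy : y ∈ B') (h : ConnIn G {v}ᶜ z y) : B = B' := by
  obtain ⟨U, hU, h1, h2⟩ := hB.isNonseparable.exists_superset hB'.isNonseparable hv hv' hz hy h
  exact (hB.eq_of_subset hU h1).trans (hB'.eq_of_subset hU h2).symm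

theorem IsBlock.exists_ne (hB : IsBlock G B) (hB' : IsBlock G B') (hne : B ≠ B') (hv' : v ∈ B') :
    ∃ x ∈ B, x ≠ v := by
  by_contra! h
  exact hne (hB.eq_of_subset hB'.isNonseparable fun x hx => (h x hx) ▸ hv')

/-- `a` is the vertex just before the first visit of the walk to `v`. -/
theorem exists_adj_connIn_compl (p : G.Walk x v) (hx : x ≠ v) :
    ∃ a, G.Adj a v ∧ ConnIn G {v}ᶜ x a := by
  induction p with
  | nil => exact absurd rfl hx
  | @cons u b w h p ih =>
    by_cases hb : b = w
    · subst hb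
      exact ⟨u, h, .refl hx⟩
    · obtain ⟨a, ha, hc⟩ := ih hb
      exact ⟨a, ha, (ConnIn.of_adj h hx hb).trans hc⟩

variable [Finite V]

theorem IsNonseparable.exists_isBlock (h : IsNonseparable G S) : ∃ B, IsBlock G B ∧ S ⊆ B := by
  obtain ⟨B, hSB, hB⟩ := (Set.toFinite {S | IsNonseparable G S}).exists_le_maximal h
  exact ⟨B, hB, hSB⟩

theorem exists_isBlock_mem (G : SimpleGraph V) (v : V) : ∃ B, IsBlock G B ∧ v ∈ B := by
  obtain ⟨B, hB, h⟩ := (isNonseparable_of_isClique (G := G) (Set.singleton_nonempty v)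
    (by rintro x rfl y rfl h; exact absurd rfl h)).exists_isBlock
  exact ⟨B, hB, h rfl⟩

theorem exists_isBlock_of_adj (h : G.Adj x y) : ∃ B, IsBlock G B ∧ x ∈ B ∧ y ∈ B := by
  obtain ⟨B, hB, hs⟩ := (isNonseparable_of_isClique (G := G) (S := {x, y}) ⟨x, .inl rfl⟩ (by
    rintro a (rfl | rfl) b (rfl | rfl) hab
    exacts [absurd rfl hab, h, h.symm, absurd rfl hab])).exists_isBlock
  exact ⟨B, hB, hs (.inl rfl), hs (.inr rfl)⟩

/-- The cut vertices are the vertices that lie in at least two blocks. -/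
theorem isCutVertex_iff_exists_isBlock :
    IsCutVertex G v ↔ ∃ B B', IsBlock G B ∧ IsBlock G B' ∧ B ≠ B' ∧ v ∈ B ∧ v ∈ B' := by
  classical
  rw [isCutVertex_iff]
  constructor
  · rintro ⟨x, y, hx, hy, ⟨p⟩, hn⟩
    have hvp : v ∈ p.support := by
      by_contra hvp
      exact hn ⟨p, fun a ha e => hvp (e ▸ ha)⟩
    obtain ⟨a, hav, hxa⟩ := exists_adj_connIn_compl (p.takeUntil v hvp) hx
    obtain ⟨b, hbv, hyb⟩ := exists_adj_connIn_compl (p.dropUntil v hvp).reverse hy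
    obtain ⟨B, hB, haB, hvB⟩ := exists_isBlock_of_adj hav
    obtain ⟨B', hB', hbB', hvB'⟩ := exists_isBlock_of_adj hbv
    refine ⟨B, B', hB, hB', ?_, hvB, hvB'⟩
    rintro rfl
    exact hn (hxa.trans
      ((hB.isNonseparable.connIn_compl haB hav.ne hbB' hbv.ne).trans hyb.symm))
  · rintro ⟨B, B', hB, hB', hne, hv, hv'⟩
    obtain ⟨x, hx, hxv⟩ := hB.exists_ne hB' hne hv'
    obtain ⟨y, hy, hyv⟩ := hB'.exists_ne hB hne.symm hv
    exact ⟨x, y, hxv, hyv, (hB.isNonseparable.connIn hx hv).reachable.trans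
      (hB'.isNonseparable.connIn hv' hy).reachable,
      fun h => hne (hB.eq_of_connIn hB' hv hv' hx hy h)⟩

end Nonseparable

/-! ### The incidence graph of vertices and blocks is a forest. -/

section Incidence

variable {V : Type*} {G : SimpleGraph V}

/-- The bipartite incidence graph of the vertices and the blocks of `G`. -/
def blockIncidenceGraph (G : SimpleGraph V) : SimpleGraph (V ⊕ {S : Set V // IsBlock G S}) where
  Adj
    | Sum.inl v, Sum.inr B => v ∈ B.1
    | Sum.inr B, Sum.inl v => v ∈ B.1
    | _, _ => False
  symm := ⟨by rintro (a | a) (b | b) h <;> exact h⟩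
  loopless := ⟨by rintro (a | a) h <;> exact h⟩

theorem isAcyclic_blockIncidenceGraph (G : SimpleGraph V) : (blockIncidenceGraph G).IsAcyclic := by
  have key : ∀ (v : V) (B : {S : Set V // IsBlock G S}), v ∈ B.1 →
      (blockIncidenceGraph G).IsBridge s(Sum.inr B, Sum.inl v) := by
    intro v B hv
    rw [SimpleGraph.isBridge_iff]
    rintro ⟨p⟩
    -- Invariant along a walk from `B` that does not use the edge to `v`: every vertex met is joined
    -- to `B` in `G` off `v`. Arriving at `v` would take a block through `v` other than `B` but
    -- joined to `B` off `v`, contrary to `IsBlock.eq_of_connIn`.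
    let P : V ⊕ {S : Set V // IsBlock G S} → Prop := fun a => match a with
      | Sum.inl x => ∃ z ∈ B.1, ConnIn G {v}ᶜ z x
      | Sum.inr C => C = B ∨ ∃ z ∈ B.1, ∃ y ∈ C.1, ConnIn G {v}ᶜ z y
    have hP : P (Sum.inl v) := by
      refine ConnIn.induction_on (S := Set.univ) ⟨p, fun _ _ => trivial⟩ (P := P) (.inl rfl) ?_
      rintro (x | C) - (x' | C') - hadj hPa
      · exact hadj.1.elim
      · have hx : x ∈ C'.1 := hadj.1
        obtain ⟨z, hz, hc⟩ := hPa
        exact .inr ⟨z, hz, x, hx, hc⟩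
      · have hx : x' ∈ C.1 := hadj.1
        by_cases hxv : x' = v
        · subst hxv
          rcases hPa with rfl | ⟨z, hz, y, hy, hc⟩
          · exact absurd (by simp) hadj.2
          · obtain rfl : B = C := Subtype.ext (B.2.eq_of_connIn C.2 hv hx hz hy hc)
            exact absurd (by simp) hadj.2
        · rcases hPa with rfl | ⟨z, hz, y, hy, hc⟩
          · exact ⟨x', hx, .refl hxv⟩
          · exact ⟨z, hz, hc.trans (C.2.isNonseparable.connIn_compl hy hc.right_mem hx hxv)⟩
      · exact hadj.1.elim
    obtain ⟨z, -, hc⟩ := hP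
    exact hc.right_mem rfl
  rw [SimpleGraph.isAcyclic_iff_forall_adj_isBridge]
  rintro (v | B) (w | C) h
  · exact h.elim
  · rw [Sym2.eq_swap]
    exact key v C h
  · exact key w B h
  · exact h.elim

/-- In an acyclic graph two distinct neighbours of `s` are separated by `s`. -/
theorem not_connIn_compl_of_isAcyclic {T : SimpleGraph V} (hT : T.IsAcyclic) {s a b : V}
    (ha : T.Adj s a) (hb : T.Adj s b) (hab : a ≠ b) : ¬ ConnIn T {s}ᶜ a b := by
  classical
  rintro ⟨p, hp⟩
  have hs : s ∉ p.bypass.support := fun h => hp s (p.support_bypass_subset_support h) rfl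
  have := (hT.subsingleton_path a b).elim ⟨p.bypass, p.bypass_isPath⟩
    ⟨.cons ha.symm (.cons hb .nil), by simp [SimpleGraph.Walk.isPath_def, ha.ne', hb.ne, hab]⟩
  refine hs ?_
  rw [show p.bypass = _ from congrArg Subtype.val this]
  simp

end Incidence

/-! ### Cliques glued together in a tree-like way. -/

section CliqueTree

variable {X ι : Type*} {G : SimpleGraph X} {K : ι → Set X} {S : Set X}

/-- `G` is the union of the cliques on the sets `K i`, and two of these sets that share a vertex `s`
are separated by `s`. -/
structure IsCliqueTree (G : SimpleGraph X) (K : ι → Set X) : Prop where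
  adj_iff : ∀ x y, G.Adj x y ↔ x ≠ y ∧ ∃ i, x ∈ K i ∧ y ∈ K i
  eq_of_connIn : ∀ i j s x y, s ∈ K i → s ∈ K j → x ∈ K i → y ∈ K j → ConnIn G {s}ᶜ x y → i = j

/-- Start from an edge of `S`, contained in some `K i`, and propagate along walks in `S`. For an
edge from `a ∈ K i` to `c`, contained in `K j`, another vertex `t` of `S ∩ K i` is joined to `c` off
`a`, which forces `i = j`. -/
theorem IsCliqueTree.exists_subset (h : IsCliqueTree G K) (hS : IsNonseparable G S)
    (hnt : S.Nontrivial) : ∃ i, S ⊆ K i := by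
  obtain ⟨x, hx, x', hx', hne⟩ := hnt
  obtain ⟨b, hxb, hb⟩ : ∃ b, G.Adj x b ∧ b ∈ S := by
    obtain ⟨p, hp⟩ := hS.connIn hx hx'
    cases p with
    | nil => exact absurd rfl hne
    | cons hadj p => exact ⟨_, hadj, hp _ (by simp)⟩
  obtain ⟨-, i, hxi, hbi⟩ := (h.adj_iff x b).1 hxb
  refine ⟨i, fun z hz => (hS.connIn hx hz).induction_on (P := (· ∈ K i)) hxi ?_⟩
  intro a ha c hc hac hai
  obtain ⟨-, j, haj, hcj⟩ := (h.adj_iff a c).1 hac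
  obtain ⟨t, htS, hti, hta⟩ : ∃ t ∈ S, t ∈ K i ∧ t ≠ a := by
    by_cases hax : a = x
    · exact ⟨b, hb, hbi, by rw [hax]; exact hxb.ne'⟩
    · exact ⟨x, hx, hxi, Ne.symm hax⟩
  obtain rfl := h.eq_of_connIn i j a t c hai haj hti hcj (hS.connIn_compl htS hta hc hac.ne')
  exact hcj

theorem IsCliqueTree.isNonseparable (h : IsCliqueTree G K) {i : ι} (hne : (K i).Nonempty) :
    IsNonseparable G (K i) :=
  isNonseparable_of_isClique hne fun x hx y hy hxy => (h.adj_iff x y).2 ⟨hxy, i, hx, hy⟩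

theorem IsCliqueTree.isBlock_iff (h : IsCliqueTree G K) (hne : ∀ i, (K i).Nonempty)
    (hanti : ∀ i j, K i ⊆ K j → i = j) (hcover : ∀ x, ∃ i, x ∈ K i) :
    IsBlock G S ↔ ∃ i, S = K i := by
  have key : ∀ S, IsNonseparable G S → ∃ i, S ⊆ K i := by
    intro S hS
    rcases S.subsingleton_or_nontrivial with hs | hs
    · obtain ⟨x, hx⟩ := hS.nonempty
      obtain ⟨i, hi⟩ := hcover x
      exact ⟨i, fun y hy => hs hx hy ▸ hi⟩
    · exact h.exists_subset hS hs
  constructor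
  · intro hS
    obtain ⟨i, hi⟩ := key S hS.prop
    exact ⟨i, hS.eq_of_subset (h.isNonseparable (hne i)) hi⟩
  · rintro ⟨i, rfl⟩
    refine ⟨h.isNonseparable (hne i), fun U hU hiU => ?_⟩
    obtain ⟨j, hj⟩ := key U hU
    obtain rfl := hanti i j (hiU.trans hj)
    exact hj

end CliqueTree

/-! ### Block graphs are the graphs whose blocks are cliques. -/

section BlockGraph

variable {V X : Type*}

/-- A vertex `v` together with the blocks that contain it. -/
def vertexStar (H : SimpleGraph V) (v : V) : Set (V ⊕ {S : Set V // IsBlock H S}) :=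
  {a | a = Sum.inl v ∨ ∃ B : {S : Set V // IsBlock H S}, a = Sum.inr B ∧ v ∈ B.1}

@[simp]
theorem inl_mem_vertexStar {H : SimpleGraph V} {u v : V} :
    Sum.inl u ∈ vertexStar H v ↔ u = v := by
  simp [vertexStar]

@[simp]
theorem inr_mem_vertexStar {H : SimpleGraph V} {v : V} {B : {S : Set V // IsBlock H S}} :
    Sum.inr B ∈ vertexStar H v ↔ v ∈ B.1 := by
  simp [vertexStar, Subtype.ext_iff]
  grind

/-- Distinct stars can share only blocks. A walk avoiding a shared block `B` gives a walk in the
incidence forest joining two neighbours of `B` off `B`, which is impossible. The map `g` allows both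
the blocks alone, which gives `B(H)`, and all vertices and blocks. -/
theorem isCliqueTree_vertexStar {H : SimpleGraph V} {G : SimpleGraph X}
    {g : X → V ⊕ {S : Set V // IsBlock H S}} (hg : Function.Injective g)
    (hG : ∀ x y, G.Adj x y ↔ x ≠ y ∧ ∃ v, g x ∈ vertexStar H v ∧ g y ∈ vertexStar H v) :
    IsCliqueTree G fun v => g ⁻¹' vertexStar H v := by
  refine ⟨hG, fun v v' s x y hsv hsv' hx hy hc => ?_⟩
  by_contra hne
  obtain ⟨B, hB⟩ : ∃ B, g s = Sum.inr B := by
    cases hgs : g s with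
    | inr B => exact ⟨B, rfl⟩
    | inl u =>
      rw [Set.mem_preimage, hgs, inl_mem_vertexStar] at hsv hsv'
      exact absurd (hsv.symm.trans hsv') hne
  rw [Set.mem_preimage, hB, inr_mem_vertexStar] at hsv hsv'
  have hinl : ∀ u : V, (Sum.inl u : V ⊕ {S : Set V // IsBlock H S}) ∈ ({Sum.inr B} : Set _)ᶜ := by
    simp
  have hmem : ∀ a, a ≠ s → g a ∈ ({Sum.inr B} : Set _)ᶜ := fun a ha h =>
    ha (hg ((Set.mem_singleton_iff.1 h).trans hB.symm))
  have star : ∀ a u, a ≠ s → g a ∈ vertexStar H u →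
      ConnIn (blockIncidenceGraph H) {Sum.inr B}ᶜ (g a) (Sum.inl u) := by
    intro a u ha hau
    have hm := hmem a ha
    cases hga : g a with
    | inl u' =>
      rw [hga, inl_mem_vertexStar] at hau
      subst hau
      exact .refl (hinl _)
    | inr C =>
      rw [hga, inr_mem_vertexStar] at hau
      rw [hga] at hm
      exact .of_adj hau hm (hinl _)
  refine not_connIn_compl_of_isAcyclic (isAcyclic_blockIncidenceGraph H)
    (s := Sum.inr B) (a := Sum.inl v) (b := Sum.inl v') hsv hsv' (by simpa using hne) ?_
  refine (star x v hc.left_mem hx).symm.trans (.trans ?_ (star y v' hc.right_mem hy))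
  refine hc.map (hmem x hc.left_mem) fun a ha b hb hab _ => ?_
  obtain ⟨-, u, hau, hbu⟩ := (hG a b).1 hab
  exact (star a u ha hau).trans (star b u hb hbu).symm

/-- In a block graph every nonseparable set is a clique. -/
theorem IsBlockGraph.adj_of_isNonseparable {G : SimpleGraph X} (h : IsBlockGraph G) {S : Set X}
    (hS : IsNonseparable G S) {x y : X} (hx : x ∈ S) (hy : y ∈ S) (hxy : x ≠ y) : G.Adj x y := by
  obtain ⟨k, H, ⟨f⟩⟩ := h
  have hT : IsCliqueTree G fun v => (fun x => Sum.inr (f x)) ⁻¹' vertexStar H v := by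
    refine isCliqueTree_vertexStar (fun a b hab => f.injective (Sum.inr_injective hab)) ?_
    intro a b
    rw [← f.map_adj_iff]
    simp only [inr_mem_vertexStar]
    exact and_congr_left' f.injective.ne_iff
  obtain ⟨i, hi⟩ := hT.exists_subset hS ⟨x, hx, y, hy, hxy⟩
  exact (hT.adj_iff x y).2 ⟨hxy, i, hi hx, hi hy⟩

/-- A finite graph all of whose blocks are cliques is a block graph. -/
theorem isBlockGraph_of_isBlock_isClique [Finite V] {G : SimpleGraph V}
    (h : ∀ B, IsBlock G B → ∀ x ∈ B, ∀ y ∈ B, x ≠ y → G.Adj x y) : IsBlockGraph G := by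
  let φ := Finite.equivFin (V ⊕ {S : Set V // IsBlock G S})
  -- The graph with `B(Q) ≅ G`: its vertices are the vertices and blocks of `G`, and its blocks are
  -- the stars. The private element `Sum.inl v` keeps the stars incomparable; two of them meet
  -- exactly when their centres share a block.
  let Q : SimpleGraph (Fin (Nat.card (V ⊕ {S : Set V // IsBlock G S}))) :=
    { Adj := fun a b => a ≠ b ∧ ∃ v, φ.symm a ∈ vertexStar G v ∧ φ.symm b ∈ vertexStar G v
      symm := ⟨fun a b ⟨hab, v, ha, hb⟩ => ⟨hab.symm, v, hb, ha⟩⟩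
      loopless := ⟨fun a ha => ha.1 rfl⟩ }
  have hQ : IsCliqueTree Q fun v => φ.symm ⁻¹' vertexStar G v :=
    isCliqueTree_vertexStar φ.symm.injective fun _ _ => Iff.rfl
  have hself : ∀ v, φ (Sum.inl v) ∈ φ.symm ⁻¹' vertexStar G v := by simp
  have hanti : ∀ v v', φ.symm ⁻¹' vertexStar G v ⊆ φ.symm ⁻¹' vertexStar G v' → v = v' := by
    intro v v' hvv'
    simpa using hvv' (hself v)
  have hblock : ∀ S, IsBlock Q S ↔ ∃ v, S = φ.symm ⁻¹' vertexStar G v := by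
    intro S
    refine hQ.isBlock_iff (fun v => ⟨_, hself v⟩) hanti fun a => ?_
    cases ha : φ.symm a with
    | inl v => exact ⟨v, by simp [ha]⟩
    | inr B =>
      obtain ⟨v, hv⟩ := B.2.nonempty
      exact ⟨v, by simpa [ha] using hv⟩
  let F : V → {S // IsBlock Q S} := fun v => ⟨_, (hblock _).2 ⟨v, rfl⟩⟩
  have hF : Function.Bijective F := by
    refine ⟨fun v v' hvv' => hanti v v' (congrArg Subtype.val hvv').subset, ?_⟩
    rintro ⟨S, hS⟩
    obtain ⟨v, rfl⟩ := (hblock S).1 hS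
    exact ⟨v, rfl⟩
  refine ⟨_, Q, ⟨⟨Equiv.ofBijective F hF, ?_⟩⟩⟩
  intro v v'
  change (F v ≠ F v' ∧ _) ↔ _
  rw [hF.1.ne_iff]
  constructor
  · rintro ⟨hne, a, hav, hav'⟩
    change φ.symm a ∈ vertexStar G v at hav
    change φ.symm a ∈ vertexStar G v' at hav'
    cases ha : φ.symm a with
    | inl u =>
      rw [ha, inl_mem_vertexStar] at hav hav'
      exact absurd (hav.symm.trans hav') hne
    | inr B =>
      rw [ha, inr_mem_vertexStar] at hav hav'
      exact h B.1 B.2 v hav v' hav' hne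
  · intro hadj
    obtain ⟨B, hB, hv, hv'⟩ := exists_isBlock_of_adj hadj
    refine ⟨hadj.ne, φ (Sum.inr ⟨B, hB⟩), ?_, ?_⟩
    · change φ.symm (φ _) ∈ vertexStar G v
      simpa using hv
    · change φ.symm (φ _) ∈ vertexStar G v'
      simpa using hv'

end BlockGraph

/-! ### Parity of distances in trees. -/

section Tree

variable {U : Type*} {T : SimpleGraph U} {w : U → ℕ}

theorem IsLeaf.isBlockVertex {l : U} (h : IsLeaf T l) : IsBlockVertex T l :=
  ⟨l, h, by simp⟩

theorem exists_isLeaf [Finite U] (hT : T.IsTree) : ∃ l, IsLeaf T l := by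
  classical
  have := Fintype.ofFinite U
  obtain ⟨u⟩ := hT.1.nonempty
  rcases subsingleton_or_nontrivial U with h | h
  · exact ⟨u, Set.subsingleton_of_subsingleton⟩
  · obtain ⟨l, hl⟩ := hT.exists_vert_degree_one_of_nontrivial
    obtain ⟨a, -, ha⟩ := SimpleGraph.degree_eq_one_iff_existsUnique_adj.1 hl
    exact ⟨l, fun b hb c hc => (ha b hb).trans (ha c hc).symm⟩

theorem even_dist_iff_of_alternating (hT : T.Connected) {c : U → Prop}
    (hc : ∀ u v, T.Adj u v → (c u ↔ ¬ c v)) (u v : U) : Even (T.dist u v) ↔ (c u ↔ c v) := by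
  obtain ⟨p, hp⟩ := (hT u v).exists_walk_length_eq_dist
  rw [← hp]
  clear hp
  induction p with
  | nil => simp
  | cons h p ih =>
    rw [SimpleGraph.Walk.length_cons, Nat.even_add_one, ih, hc _ _ h]
    tauto

/-- If the vertices of a finite tree are properly coloured with two colours such that all leaves
have the same colour, then the block vertices are the vertices of that colour. -/
theorem isBlockVertex_iff_of_alternating [Finite U] (hT : T.IsTree) {c : U → Prop}
    (hc : ∀ u v, T.Adj u v → (c u ↔ ¬ c v)) (hleaf : ∀ l, IsLeaf T l → c l) (u : U) :
    IsBlockVertex T u ↔ c u := by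
  constructor
  · rintro ⟨l, hl, he⟩
    exact ((even_dist_iff_of_alternating hT.1 hc u l).1 he).2 (hleaf l hl)
  · intro hu
    obtain ⟨l, hl⟩ := exists_isLeaf hT
    exact ⟨l, hl, (even_dist_iff_of_alternating hT.1 hc u l).2 (iff_of_true hu (hleaf l hl))⟩

/-- A weighted tree in which block vertices and other vertices alternate, the latter having
weight `1`, and in which leaves have positive weight. -/
structure IsAdmissible (T : SimpleGraph U) (w : U → ℕ) : Prop where
  isTree : T.IsTree
  alternating : ∀ u v, T.Adj u v → (IsBlockVertex T u ↔ ¬ IsBlockVertex T v)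
  weight_eq_one : ∀ v, ¬ IsBlockVertex T v → w v = 1
  one_le_weight : ∀ l, IsLeaf T l → 1 ≤ w l

/-- Parity of the distance from a fixed leaf is a proper 2-colouring; when all leaves are at even
distance, its even class is the set of block vertices. -/
theorem isAdmissible_iff [Finite U] :
    IsAdmissible T w ↔ T.IsTree ∧
      (∀ l l' : U, IsLeaf T l → IsLeaf T l' → Even (T.dist l l')) ∧
      (∀ v : U, ¬ IsBlockVertex T v → w v = 1) ∧ (∀ l : U, IsLeaf T l → 1 ≤ w l) := by
  constructor
  · intro h
    exact ⟨h.isTree, fun l l' hl hl' => (even_dist_iff_of_alternating h.isTree.1 h.alternating l l').2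
      (iff_of_true hl.isBlockVertex hl'.isBlockVertex), h.weight_eq_one, h.one_le_weight⟩
  · rintro ⟨hT, heven, h1, h2⟩
    obtain ⟨l, hl⟩ := exists_isLeaf hT
    have hc : ∀ u v, T.Adj u v → (Even (T.dist l u) ↔ ¬ Even (T.dist l v)) := by
      intro u v huv
      rcases hT.dist_eq_dist_add_one_of_adj l huv with h | h <;> rw [h, Nat.even_add_one]
      rw [not_not]
    have key := isBlockVertex_iff_of_alternating hT hc fun l' hl' => heven l l' hl hl'
    exact ⟨hT, fun u v huv => by rw [key, key]; exact hc u v huv, h1, h2⟩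

theorem exists_adj_ne_of_not_isBlockVertex {v : U} (hv : ¬ IsBlockVertex T v) :
    ∃ a b, T.Adj v a ∧ T.Adj v b ∧ a ≠ b := by
  have : ¬ IsLeaf T v := fun hl => hv hl.isBlockVertex
  obtain ⟨a, ha, b, hb, hab⟩ := Set.not_subsingleton_iff.1 this
  exact ⟨a, b, ha, hb, hab⟩

end Tree

/-! ### The block tree is an admissible weighted tree. -/

section BlockTree

variable {V U : Type*} {G : SimpleGraph V}

theorem isAcyclic_blockTree (G : SimpleGraph V) : (blockTree G).IsAcyclic := by
  refine (isAcyclic_blockIncidenceGraph G).comap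
    ⟨Sum.map Subtype.val id, ?_⟩ (Subtype.val_injective.sumMap Function.injective_id)
  rintro (a | a) (b | b) h
  exacts [h.elim, h, h, h.elim]

theorem blockTree_alternating (a b : BlockTreeVertex G) (h : (blockTree G).Adj a b) :
    (a.isRight = true ↔ ¬ b.isRight = true) := by
  rcases a with a | a <;> rcases b with b | b
  exacts [h.elim, by simp, by simp, h.elim]

variable [Finite V]

/-- For connectedness, cover the edges of a walk in `G` by blocks. Consecutive blocks share a
vertex, which is a cut vertex if they differ. -/
theorem isTree_blockTree (hG : G.Connected) : (blockTree G).IsTree := by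
  have share : ∀ (B C : {S : Set V // IsBlock G S}) (x : V), x ∈ B.1 → x ∈ C.1 →
      (blockTree G).Reachable (Sum.inr B) (Sum.inr C) := by
    intro B C x hB hC
    by_cases hBC : B = C
    · rw [hBC]
    have hx : IsCutVertex G x := isCutVertex_iff_exists_isBlock.2
      ⟨B.1, C.1, B.2, C.2, fun h => hBC (Subtype.ext h), hB, hC⟩
    have h1 : (blockTree G).Adj (Sum.inr B) (Sum.inl ⟨x, hx⟩) := hB
    have h2 : (blockTree G).Adj (Sum.inl ⟨x, hx⟩) (Sum.inr C) := hC
    exact h1.reachable.trans h2.reachable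
  have blocks : ∀ B C : {S : Set V // IsBlock G S},
      (blockTree G).Reachable (Sum.inr B) (Sum.inr C) := by
    intro B C
    obtain ⟨x, hx⟩ := B.2.nonempty
    obtain ⟨y, hy⟩ := C.2.nonempty
    obtain ⟨p⟩ := hG x y
    induction p generalizing B with
    | nil => exact share B C _ hx hy
    | cons h p ih =>
      obtain ⟨D, hD, h1, h2⟩ := exists_isBlock_of_adj h
      exact (share B ⟨D, hD⟩ _ hx h1).trans (ih ⟨D, hD⟩ h2 hy)
  have toBlock : ∀ a, ∃ B, (blockTree G).Reachable a (Sum.inr B) := by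
    rintro (v | B)
    · obtain ⟨B, hB, hv⟩ := exists_isBlock_mem G v.1
      have h : (blockTree G).Adj (Sum.inl v) (Sum.inr ⟨B, hB⟩) := hv
      exact ⟨_, h.reachable⟩
    · exact ⟨B, .rfl⟩
  obtain ⟨x⟩ := hG.nonempty
  obtain ⟨B, hB, -⟩ := exists_isBlock_mem G x
  have : Nonempty (BlockTreeVertex G) := ⟨Sum.inr ⟨B, hB⟩⟩
  refine ⟨⟨fun a b => ?_⟩, isAcyclic_blockTree G⟩
  obtain ⟨B, hB⟩ := toBlock a
  obtain ⟨C, hC⟩ := toBlock b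
  exact hB.trans ((blocks B C).trans hC.symm)

theorem isRight_of_isLeaf_blockTree {a : BlockTreeVertex G} (ha : IsLeaf (blockTree G) a) :
    a.isRight = true := by
  rcases a with ⟨v, hv⟩ | B
  · obtain ⟨B, C, hB, hC, hne, hvB, hvC⟩ := isCutVertex_iff_exists_isBlock.1 hv
    have := @ha (Sum.inr ⟨B, hB⟩) hvB (Sum.inr ⟨C, hC⟩) hvC
    simp only [Sum.inr.injEq, Subtype.mk.injEq] at this
    exact absurd this hne
  · rfl

theorem isBlockVertex_blockTree_iff (hG : G.Connected) (a : BlockTreeVertex G) :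
    IsBlockVertex (blockTree G) a ↔ a.isRight = true :=
  isBlockVertex_iff_of_alternating (isTree_blockTree hG) blockTree_alternating
    (fun _ => isRight_of_isLeaf_blockTree) a

theorem isAdmissible_blockTree (hG : G.Connected) :
    IsAdmissible (blockTree G) (blockTreeWeight G) := by
  refine ⟨isTree_blockTree hG, fun a b h => ?_, fun a ha => ?_, fun a ha => ?_⟩
  · simpa only [isBlockVertex_blockTree_iff hG] using blockTree_alternating a b h
  · rw [isBlockVertex_blockTree_iff hG] at ha
    rcases a with v | B
    · rfl
    · exact absurd rfl ha
  · rcases a with v | B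
    · exact absurd (isRight_of_isLeaf_blockTree ha) (by simp)
    · change 1 ≤ Set.ncard _
      rw [Nat.one_le_iff_ne_zero, Ne, Set.ncard_eq_zero, ← Ne, ← Set.nonempty_iff_ne_empty]
      obtain ⟨x, hx⟩ := B.2.nonempty
      -- A leaf block contains at most one cut vertex. If `x` is one, a second block through `x`
      -- forces `B` to have another vertex, which is then not a cut vertex.
      by_cases hcut : IsCutVertex G x
      · obtain ⟨C, hC, hne, hxC⟩ : ∃ C, IsBlock G C ∧ B.1 ≠ C ∧ x ∈ C := by
          obtain ⟨C, D, hC, hD, hne, hxC, hxD⟩ := isCutVertex_iff_exists_isBlock.1 hcut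
          by_cases h : B.1 = C
          · exact ⟨D, hD, h ▸ hne, hxD⟩
          · exact ⟨C, hC, h, hxC⟩
        obtain ⟨y, hy, hyx⟩ := B.2.exists_ne hC hne hxC
        refine ⟨y, hy, fun hycut => hyx ?_⟩
        have := @ha (Sum.inl ⟨y, hycut⟩) hy (Sum.inl ⟨x, hcut⟩) hx
        simpa using this
      · exact ⟨x, hx, hcut⟩

end BlockTree

/-! ### Invariance under isomorphism. -/

section Iso

variable {U U' : Type*} {T : SimpleGraph U} {T' : SimpleGraph U'}

theorem isLeaf_iso_iff (f : T ≃g T') {u : U} : IsLeaf T' (f u) ↔ IsLeaf T u := by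
  constructor
  · intro h a ha b hb
    exact f.injective (h (f.map_adj_iff.2 ha) (f.map_adj_iff.2 hb))
  · intro h a ha b hb
    obtain ⟨a, rfl⟩ := f.surjective a
    obtain ⟨b, rfl⟩ := f.surjective b
    exact congrArg f (h (f.map_adj_iff.1 ha) (f.map_adj_iff.1 hb))

theorem isBlockVertex_iso_iff (f : T ≃g T') (hT : T'.Connected) {u : U} :
    IsBlockVertex T' (f u) ↔ IsBlockVertex T u := by
  have hdist : ∀ a b, T'.dist (f a) (f b) = T.dist a b := by
    intro a b
    have hT0 : T.Connected := f.connected_iff.2 hT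
    refine le_antisymm ?_ ?_
    · obtain ⟨p, hp⟩ := (hT0 a b).exists_walk_length_eq_dist
      rw [← hp, ← SimpleGraph.Walk.length_map f.toHom p]
      exact SimpleGraph.dist_le _
    · obtain ⟨p, hp⟩ := (hT (f a) (f b)).exists_walk_length_eq_dist
      rw [← hp, ← SimpleGraph.Walk.length_map f.symm.toHom p]
      simpa using SimpleGraph.dist_le (p.map f.symm.toHom)
  unfold IsBlockVertex
  rw [f.surjective.exists]
  simp only [isLeaf_iso_iff, hdist]

theorem IsAdmissible.of_weightedIso {w : U → ℕ} {w' : U' → ℕ} (h : IsAdmissible T w)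
    (hiso : WeightedIso T w T' w') : IsAdmissible T' w' := by
  obtain ⟨f, hf⟩ := hiso
  have hT' : T'.IsTree := f.isTree_iff.1 h.isTree
  refine ⟨hT', ?_, ?_, ?_⟩
  · simp only [f.surjective.forall, isBlockVertex_iso_iff f hT'.1, f.map_adj_iff]
    exact h.alternating
  · simp only [f.surjective.forall, isBlockVertex_iso_iff f hT'.1, hf]
    exact h.weight_eq_one
  · simp only [f.surjective.forall, isLeaf_iso_iff f, hf]
    exact h.one_le_weight

end Iso

/-! ### Graphs represented by a weighted tree. -/

section Represents

variable {V W U : Type*} {G : SimpleGraph V} {T : SimpleGraph U} {w : U → ℕ} {t : V → U}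

/-- The vertices that `t` sends to the block vertex `B` of `T` or to a neighbour of `B`. -/
def bag (T : SimpleGraph U) (t : V → U) (B : {B : U // IsBlockVertex T B}) : Set V :=
  {x | t x = B.1 ∨ T.Adj B.1 (t x)}

/-- `t` exhibits `G` as the graph described by the weighted tree `(T, w)`: exactly `w u` vertices
lie over `u`, and `G` is the union of the cliques on the bags. -/
structure Represents (G : SimpleGraph V) (T : SimpleGraph U) (w : U → ℕ) (t : V → U) : Prop where
  ncard_fiber : ∀ u, {x | t x = u}.ncard = w u
  adj_iff : ∀ x y, G.Adj x y ↔ x ≠ y ∧ ∃ B, x ∈ bag T t B ∧ y ∈ bag T t B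

/-- Any bijection respecting the fibres works, since adjacency of distinct vertices depends only on
their images in `T`. -/
theorem Represents.nonempty_iso [Finite V] [Finite W] {G' : SimpleGraph W} {t' : W → U}
    (h : Represents G T w t) (h' : Represents G' T w t') : Nonempty (G ≃g G') := by
  have hcard : ∀ u, Nonempty ({x // t x = u} ≃ {y // t' y = u}) := fun u =>
    Finite.card_eq.1 ((h.ncard_fiber u).trans (h'.ncard_fiber u).symm)
  let e := Equiv.ofFiberEquiv fun u => (hcard u).some
  have he : ∀ x, t' (e x) = t x := Equiv.ofFiberEquiv_map _
  refine ⟨⟨e, ?_⟩⟩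
  intro x y
  simp only [h.adj_iff, h'.adj_iff, bag, Set.mem_ofPred_eq, he, e.injective.ne_iff]

theorem Represents.comp_iso {G' : SimpleGraph W} (h : Represents G T w t) (f : G' ≃g G) :
    Represents G' T w (t ∘ f) := by
  refine ⟨fun u => ?_, fun x y => ?_⟩
  · rw [← h.ncard_fiber u]
    exact Nat.card_congr (f.toEquiv.subtypeEquiv fun _ => Iff.rfl)
  · rw [← f.map_adj_iff, h.adj_iff, f.injective.ne_iff]
    rfl

theorem Represents.of_weightedIso {U' : Type*} {T' : SimpleGraph U'} {w' : U' → ℕ}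
    (h : Represents G T w t) (hT : T'.Connected) (hiso : WeightedIso T w T' w') :
    ∃ t' : V → U', Represents G T' w' t' := by
  obtain ⟨f, hf⟩ := hiso
  refine ⟨f ∘ t, fun u => ?_, fun x y => ?_⟩
  · obtain ⟨u, rfl⟩ := f.surjective u
    rw [hf, ← h.ncard_fiber u]
    simp only [Function.comp_apply, f.injective.eq_iff]
  · rw [h.adj_iff]
    refine and_congr_right fun _ => ?_
    simp only [Subtype.exists, f.surjective.exists, isBlockVertex_iso_iff f hT, bag,
      Set.mem_ofPred_eq, Function.comp_apply, f.injective.eq_iff, f.map_adj_iff]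

theorem Represents.card_eq [Fintype U] [Finite V] (h : Represents G T w t) :
    Nat.card V = ∑ u, w u := by
  rw [← Nat.card_congr (Equiv.sigmaFiberEquiv t), Nat.card_sigma]
  exact Finset.sum_congr rfl fun u _ => h.ncard_fiber u

/-- A finite connected graph whose blocks are cliques is represented by its block tree. -/
theorem exists_represents_blockTree [Finite V] (hG : G.Connected)
    (hclique : ∀ B, IsBlock G B → ∀ x ∈ B, ∀ y ∈ B, x ≠ y → G.Adj x y) :
    ∃ t, Represents G (blockTree G) (blockTreeWeight G) t := by
  -- The map `t` sends a cut vertex to itself and any other vertex to the unique block containing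
  -- it.
  have ex : ∀ x, ∃ a : BlockTreeVertex G, (∀ v, a = Sum.inl v ↔ x = v.1) ∧
      ∀ C, a = Sum.inr C ↔ x ∈ C.1 ∧ ¬ IsCutVertex G x := by
    intro x
    by_cases hx : IsCutVertex G x
    · refine ⟨Sum.inl ⟨x, hx⟩, fun v => ?_, fun C => ?_⟩
      · rw [Sum.inl.injEq, Subtype.ext_iff]
      · simp [hx]
    · obtain ⟨B, hB, hxB⟩ := exists_isBlock_mem G x
      refine ⟨Sum.inr ⟨B, hB⟩, fun v => ?_, fun C => ?_⟩
      · simp only [reduceCtorEq, false_iff]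
        rintro rfl
        exact hx v.2
      · rw [Sum.inr.injEq, Subtype.ext_iff]
        constructor
        · rintro rfl
          exact ⟨hxB, hx⟩
        · rintro ⟨hxC, -⟩
          by_contra hne
          exact hx (isCutVertex_iff_exists_isBlock.2 ⟨B, C.1, hB, C.2, hne, hxB, hxC⟩)
  choose t ht1 ht2 using ex
  have hbag : ∀ (C : {S : Set V // IsBlock G S}) (hC : IsBlockVertex (blockTree G) (Sum.inr C)) x,
      x ∈ bag (blockTree G) t ⟨Sum.inr C, hC⟩ ↔ x ∈ C.1 := by
    intro C hC x
    constructor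
    · rintro (hx | hx)
      · exact ((ht2 x C).1 hx).1
      · cases htx : t x with
        | inl v =>
          rw [htx] at hx
          rw [(ht1 x v).1 htx]
          exact hx
        | inr D =>
          rw [htx] at hx
          exact hx.elim
    · intro hx
      by_cases hcut : IsCutVertex G x
      · right
        rw [(ht1 x ⟨x, hcut⟩).2 rfl]
        exact hx
      · exact .inl ((ht2 x C).2 ⟨hx, hcut⟩)
  refine ⟨t, fun a => ?_, fun x y => ?_⟩
  · rcases a with v | C
    · simp only [ht1]
      exact Set.ncard_singleton v.1
    · simp only [ht2]
      rfl
  · constructor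
    · intro hadj
      obtain ⟨B, hB, hx, hy⟩ := exists_isBlock_of_adj hadj
      have hBV := (isBlockVertex_blockTree_iff hG (Sum.inr ⟨B, hB⟩)).2 rfl
      exact ⟨hadj.ne, ⟨_, hBV⟩, (hbag _ hBV x).2 hx, (hbag _ hBV y).2 hy⟩
    · rintro ⟨hne, ⟨a, ha⟩, hx, hy⟩
      rcases a with v | C
      · exact absurd ((isBlockVertex_blockTree_iff hG _).1 ha) (by simp)
      · rw [hbag] at hx hy
        exact hclique C.1 C.2 x hx y hy hne

theorem Represents.exists_eq (h : Represents G T w t) {u : U} (hu : w u ≠ 0) : ∃ x, t x = u := by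
  rw [← h.ncard_fiber] at hu
  exact Set.nonempty_of_ncard_ne_zero hu

theorem Represents.existsUnique_eq (h : Represents G T w t) (hT : IsAdmissible T w) {u : U}
    (hu : ¬ IsBlockVertex T u) : ∃ x, t x = u ∧ ∀ y, t y = u → y = x := by
  obtain ⟨x, hx⟩ := Set.ncard_eq_one.1 ((h.ncard_fiber u).trans (hT.weight_eq_one u hu))
  simp only [Set.ext_iff, Set.mem_ofPred_eq, Set.mem_singleton_iff] at hx
  exact ⟨x, (hx x).2 rfl, fun y hy => (hx y).1 hy⟩

theorem IsAdmissible.not_isBlockVertex_of_adj (hT : IsAdmissible T w) {u v : U}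
    (hu : IsBlockVertex T u) (h : T.Adj u v) : ¬ IsBlockVertex T v :=
  (hT.alternating u v h).1 hu

theorem IsAdmissible.isBlockVertex_of_adj (hT : IsAdmissible T w) {u v : U}
    (hu : ¬ IsBlockVertex T u) (h : T.Adj u v) : IsBlockVertex T v :=
  (hT.alternating v u h.symm).2 hu

/-- A vertex over a block vertex lies in no other bag. -/
theorem IsAdmissible.mem_bag_iff_of_isBlockVertex (hT : IsAdmissible T w) {x : V}
    (hx : IsBlockVertex T (t x)) {B : {B : U // IsBlockVertex T B}} :
    x ∈ bag T t B ↔ t x = B.1 :=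
  ⟨fun h => h.resolve_right fun hadj => hT.not_isBlockVertex_of_adj B.2 hadj hx, .inl⟩

theorem mem_bag_iff_of_not_isBlockVertex {x : V}
    (hx : ¬ IsBlockVertex T (t x)) {B : {B : U // IsBlockVertex T B}} :
    x ∈ bag T t B ↔ T.Adj B.1 (t x) :=
  ⟨fun h => h.resolve_left fun he => hx (he ▸ B.2), .inr⟩

/-- A vertex `s` in two bags lies over a non-block vertex, and weight `1` makes it the only one
there. Hence walks avoiding `s` project to walks in `T` avoiding `t s`, and acyclicity of `T`
applies. -/
theorem Represents.isCliqueTree (h : Represents G T w t) (hT : IsAdmissible T w) :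
    IsCliqueTree G (bag T t) := by
  refine ⟨h.adj_iff, fun B C s x y hsB hsC hx hy hc => ?_⟩
  by_contra hne
  have hne' : B.1 ≠ C.1 := fun e => hne (Subtype.ext e)
  have hs : ¬ IsBlockVertex T (t s) := by
    intro hs
    rw [hT.mem_bag_iff_of_isBlockVertex hs] at hsB hsC
    exact hne' (hsB.symm.trans hsC)
  have hmem : ∀ a, a ≠ s → t a ∈ ({t s} : Set U)ᶜ := by
    intro a ha hta
    obtain ⟨z, -, hz⟩ := h.existsUnique_eq hT hs
    exact ha ((hz a hta).trans (hz s rfl).symm)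
  have toB : ∀ a (D : {B : U // IsBlockVertex T B}), a ≠ s → a ∈ bag T t D →
      ConnIn T {t s}ᶜ (t a) D.1 := by
    intro a D ha haD
    have hD : D.1 ∈ ({t s} : Set U)ᶜ := fun e => hs ((Set.mem_singleton_iff.1 e) ▸ D.2)
    rcases haD with e | hadj
    · rw [e]
      exact .refl hD
    · exact .of_adj hadj.symm (hmem a ha) hD
  rw [mem_bag_iff_of_not_isBlockVertex hs] at hsB hsC
  refine not_connIn_compl_of_isAcyclic hT.isTree.2 hsB.symm hsC.symm hne' ?_
  refine (toB x B hc.left_mem hx).symm.trans (.trans ?_ (toB y C hc.right_mem hy))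
  refine hc.map (hmem x hc.left_mem) fun a ha b hb hab _ => ?_
  obtain ⟨-, D, haD, hbD⟩ := (h.adj_iff a b).1 hab
  exact (toB a D ha haD).trans (toB b D hb hbD).symm

theorem Represents.bag_nonempty (h : Represents G T w t) (hT : IsAdmissible T w)
    (B : {B : U // IsBlockVertex T B}) : (bag T t B).Nonempty := by
  by_cases hB : w B.1 = 0
  · have hl : ¬ IsLeaf T B.1 := fun hl => by
      have := hT.one_le_weight _ hl
      omega
    obtain ⟨v, hv, -⟩ := Set.not_subsingleton_iff.1 hl
    obtain ⟨x, hx, -⟩ := h.existsUnique_eq hT (hT.not_isBlockVertex_of_adj B.2 hv)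
    exact ⟨x, .inr (hx ▸ hv)⟩
  · obtain ⟨x, hx⟩ := h.exists_eq hB
    exact ⟨x, .inl hx⟩

/-- A vertex over `B` lies in no other bag. If there is none, `B` is not a leaf, and two of its
neighbours would also be neighbours of `C`, closing a 4-cycle in `T`. -/
theorem Represents.bag_subset (h : Represents G T w t) (hT : IsAdmissible T w)
    (B C : {B : U // IsBlockVertex T B}) (hBC : bag T t B ⊆ bag T t C) : B = C := by
  by_contra hne
  have hne' : B.1 ≠ C.1 := fun e => hne (Subtype.ext e)
  by_cases hB : w B.1 = 0
  · have hl : ¬ IsLeaf T B.1 := fun hl => by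
      have := hT.one_le_weight _ hl
      omega
    obtain ⟨v, hv, v', hv', hvv'⟩ := Set.not_subsingleton_iff.1 hl
    have adjC : ∀ u, T.Adj B.1 u → T.Adj C.1 u := by
      intro u hu
      have hnu := hT.not_isBlockVertex_of_adj B.2 hu
      obtain ⟨x, rfl, -⟩ := h.existsUnique_eq hT hnu
      rw [← mem_bag_iff_of_not_isBlockVertex hnu]
      exact hBC (.inr hu)
    refine not_connIn_compl_of_isAcyclic hT.isTree.2 hv hv' hvv' ?_
    exact (ConnIn.of_adj (adjC v hv).symm (Ne.symm hv.ne) (Ne.symm hne')).trans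
      (.of_adj (adjC v' hv') (Ne.symm hne') (Ne.symm hv'.ne))
  · obtain ⟨x, hx⟩ := h.exists_eq hB
    have hxC := hBC (.inl hx : x ∈ bag T t B)
    rw [hT.mem_bag_iff_of_isBlockVertex (hx ▸ B.2)] at hxC
    exact hne' (hx.symm.trans hxC)

theorem IsAdmissible.exists_mem_bag (hT : IsAdmissible T w) (x : V) : ∃ B, x ∈ bag T t B := by
  by_cases hx : IsBlockVertex T (t x)
  · exact ⟨⟨_, hx⟩, .inl rfl⟩
  · obtain ⟨a, -, ha, -⟩ := exists_adj_ne_of_not_isBlockVertex hx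
    exact ⟨⟨a, hT.isBlockVertex_of_adj hx ha⟩, .inr ha.symm⟩

/-- The blocks of a represented graph are its bags. -/
theorem Represents.isBlock_iff (h : Represents G T w t) (hT : IsAdmissible T w) {S : Set V} :
    IsBlock G S ↔ ∃ B, S = bag T t B :=
  (h.isCliqueTree hT).isBlock_iff (h.bag_nonempty hT) (h.bag_subset hT) hT.exists_mem_bag

theorem Represents.isBlockGraph [Finite V] (h : Represents G T w t) (hT : IsAdmissible T w) :
    IsBlockGraph G := by
  refine isBlockGraph_of_isBlock_isClique fun S hS x hx y hy hxy => ?_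
  obtain ⟨B, rfl⟩ := (h.isBlock_iff hT).1 hS
  exact (h.adj_iff x y).2 ⟨hxy, B, hx, hy⟩

theorem Represents.isCutVertex_iff [Finite V] (h : Represents G T w t) (hT : IsAdmissible T w)
    {x : V} : IsCutVertex G x ↔ ¬ IsBlockVertex T (t x) := by
  rw [isCutVertex_iff_exists_isBlock]
  constructor
  · rintro ⟨S, S', hS, hS', hne, hx, hx'⟩ hB
    obtain ⟨B, rfl⟩ := (h.isBlock_iff hT).1 hS
    obtain ⟨C, rfl⟩ := (h.isBlock_iff hT).1 hS'
    rw [hT.mem_bag_iff_of_isBlockVertex hB] at hx hx'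
    exact hne (congrArg _ (Subtype.ext (hx.symm.trans hx')))
  · intro hx
    obtain ⟨a, b, ha, hb, hab⟩ := exists_adj_ne_of_not_isBlockVertex hx
    have hBa := hT.isBlockVertex_of_adj hx ha
    have hBb := hT.isBlockVertex_of_adj hx hb
    refine ⟨bag T t ⟨a, hBa⟩, bag T t ⟨b, hBb⟩, (h.isBlock_iff hT).2 ⟨_, rfl⟩,
      (h.isBlock_iff hT).2 ⟨_, rfl⟩, fun e => hab ?_, .inr ha.symm, .inr hb.symm⟩
    exact congrArg Subtype.val (h.bag_subset hT _ _ e.subset)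

theorem Represents.reachable_of_mem_bag (h : Represents G T w t)
    {B : {B : U // IsBlockVertex T B}} {x y : V} (hx : x ∈ bag T t B) (hy : y ∈ bag T t B) :
    G.Reachable x y := by
  by_cases hxy : x = y
  · rw [hxy]
  · exact ((h.adj_iff x y).2 ⟨hxy, B, hx, hy⟩).reachable

theorem Represents.connected [Finite U] (h : Represents G T w t) (hT : IsAdmissible T w) :
    G.Connected := by
  obtain ⟨l, hl⟩ := exists_isLeaf hT.isTree
  obtain ⟨x₀, hx₀⟩ := h.exists_eq (Nat.one_le_iff_ne_zero.1 (hT.one_le_weight l hl))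
  -- The fibre over a block vertex may be empty, so the induction along `T` also covers the vertices
  -- over neighbours of `u`.
  have key : ∀ u, ∀ x, (t x = u ∨ T.Adj u (t x)) → G.Reachable x₀ x := by
    intro u
    obtain ⟨p⟩ := hT.isTree.1 l u
    refine ConnIn.induction_on (S := Set.univ) ⟨p, fun _ _ => trivial⟩
      (P := fun u => ∀ x, (t x = u ∨ T.Adj u (t x)) → G.Reachable x₀ x) ?_ ?_
    · intro x hx
      exact h.reachable_of_mem_bag (B := ⟨l, hl.isBlockVertex⟩) (.inl hx₀) hx
    · intro a _ b _ hab ih x hx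
      by_cases hb : IsBlockVertex T b
      · obtain ⟨y, rfl, -⟩ := h.existsUnique_eq hT (hT.not_isBlockVertex_of_adj hb hab.symm)
        exact (ih y (.inl rfl)).trans
          (h.reachable_of_mem_bag (B := ⟨b, hb⟩) (.inr hab.symm) hx)
      · obtain ⟨y, rfl, hy⟩ := h.existsUnique_eq hT hb
        refine (ih y (.inr hab)).trans ?_
        rcases hx with hx | hx
        · rw [hy x hx]
        · exact h.reachable_of_mem_bag (B := ⟨_, hT.isBlockVertex_of_adj hb hx⟩)
            (.inr hx.symm) (.inl rfl)
  have : Nonempty V := ⟨x₀⟩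
  exact ⟨fun x y => (key _ x (.inl rfl)).symm.trans (key _ y (.inl rfl))⟩

/-- The block tree of a represented graph is the representing weighted tree. -/
theorem Represents.weightedIso [Finite V] (h : Represents G T w t) (hT : IsAdmissible T w) :
    WeightedIso (blockTree G) (blockTreeWeight G) T w := by
  have hex : ∀ S : {S : Set V // IsBlock G S}, ∃ B, S.1 = bag T t B :=
    fun S => (h.isBlock_iff hT).1 S.2
  choose β hβ using hex
  let F : BlockTreeVertex G → U := Sum.elim (fun v => t v.1) fun S => (β S).1
  have hFinl : ∀ v, ¬ IsBlockVertex T (F (Sum.inl v)) := fun v => (h.isCutVertex_iff hT).1 v.2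
  have hFinr : ∀ S, IsBlockVertex T (F (Sum.inr S)) := fun S => (β S).2
  have hbij : Function.Bijective F := by
    constructor
    · rintro (v | S) (v' | S') he
      · obtain ⟨z, -, hz⟩ := h.existsUnique_eq hT (hFinl v')
        exact congrArg _ (Subtype.ext ((hz v.1 he).trans (hz v'.1 rfl).symm))
      · exact absurd (he ▸ hFinr S') (hFinl v)
      · exact absurd (he ▸ hFinr S) (hFinl v')
      · refine congrArg _ (Subtype.ext ?_)
        rw [hβ S, hβ S', show β S = β S' from Subtype.ext he]
    · intro u
      by_cases hu : IsBlockVertex T u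
      · have hb : IsBlock G (bag T t ⟨u, hu⟩) := (h.isBlock_iff hT).2 ⟨_, rfl⟩
        refine ⟨Sum.inr ⟨_, hb⟩, ?_⟩
        exact (congrArg Subtype.val (h.bag_subset hT _ _ (hβ ⟨_, hb⟩).subset)).symm
      · obtain ⟨x, rfl, -⟩ := h.existsUnique_eq hT hu
        exact ⟨Sum.inl ⟨x, (h.isCutVertex_iff hT).2 hu⟩, rfl⟩
  have hadj : ∀ v S, T.Adj (F (Sum.inr S)) (F (Sum.inl v)) ↔ v.1 ∈ S.1 := by
    intro v S
    rw [hβ S]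
    exact (mem_bag_iff_of_not_isBlockVertex (t := t) (x := v.1) (hFinl v)).symm
  refine ⟨⟨Equiv.ofBijective F hbij, ?_⟩, ?_⟩
  · intro a b
    change T.Adj (F a) (F b) ↔ _
    rcases a with v | S <;> rcases b with v' | S'
    · exact iff_of_false (fun hvv' => hFinl v' (hT.isBlockVertex_of_adj (hFinl v) hvv')) id
    · rw [T.adj_comm]
      exact hadj v S'
    · exact hadj v' S
    · exact iff_of_false (fun hSS' => hT.not_isBlockVertex_of_adj (hFinr S) hSS' (hFinr S')) id
  · intro a
    change w (F a) = _
    rcases a with v | S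
    · exact hT.weight_eq_one _ (hFinl v)
    · rw [← h.ncard_fiber]
      change _ = Set.ncard _
      congr 1
      ext x
      simp only [Set.mem_ofPred_eq, h.isCutVertex_iff hT, not_not]
      rw [hβ S]
      constructor
      · intro hx
        exact ⟨.inl hx, hx ▸ hFinr S⟩
      · rintro ⟨hx, hB⟩
        exact (hT.mem_bag_iff_of_isBlockVertex hB).1 hx

end Represents

/-! ### The glued cliques. -/

section Glued

variable {U : Type*} {T : SimpleGraph U} {w : U → ℕ}

/-- Gluing is already transitive, because injectivity of the choices means that a clique vertex is
chosen for at most one neighbour. Equality is listed separately since unchosen vertices are not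
glued even to themselves. -/
theorem mk_eq_mk_iff_glued (e : GluingChoice T w) (x y : CliqueVertex T w) :
    Quot.mk (Glued e) x = Quot.mk (Glued e) y ↔ x = y ∨ Glued e x y := by
  constructor
  · intro h
    replace h := Quot.eqvGen_exact h
    induction h with
    | rel x y h => exact .inr h
    | refl x => exact .inl rfl
    | symm x y h ih =>
      rcases ih with rfl | ⟨v, hx, hy, h1, h2⟩
      · exact .inl rfl
      · exact .inr ⟨v, hy, hx, h2, h1⟩
    | trans x y z h h' ih ih' =>
      rcases ih with rfl | ⟨v, hx, hy, h1, h2⟩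
      · exact ih'
      · rcases ih' with rfl | ⟨v', hy', hz, h3, h4⟩
        · exact .inr ⟨v, hx, hy, h1, h2⟩
        · obtain rfl : v = v' := congrArg Subtype.val ((e y.1).injective (h2.symm.trans h3))
          exact .inr ⟨v, hx, hz, h1, h4⟩
  · rintro (rfl | h)
    · rfl
    · exact Quot.sound h

/-- The glued graph is represented by the weighted tree from which it is built. -/
theorem exists_represents_gluedGraph [Finite U] (hT : IsAdmissible T w) (e : GluingChoice T w) :
    ∃ t, Represents (gluedGraph e) T w t := by
  -- A chosen clique vertex is sent to the neighbour it was chosen for, an unchosen one to its block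
  -- vertex.
  have ex : ∀ x : CliqueVertex T w, ∃ u, (u = x.1.1 ∨ T.Adj x.1.1 u) ∧
      (∀ v (hv : T.Adj x.1.1 v), u = v ↔ x.2 = e x.1 ⟨v, hv⟩) ∧
      (u = x.1.1 ↔ x.2 ∈ (Set.range (e x.1))ᶜ) := by
    rintro ⟨B, i⟩
    by_cases hi : i ∈ Set.range (e B)
    · obtain ⟨⟨u, hu⟩, rfl⟩ := hi
      refine ⟨u, .inr hu, fun v hv => ?_, iff_of_false (Ne.symm (SimpleGraph.Adj.ne hu)) ?_⟩
      · exact Subtype.mk_eq_mk.symm.trans (e B).injective.eq_iff.symm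
      · exact fun h => h ⟨_, rfl⟩
    · exact ⟨B.1, .inl rfl, fun v hv => iff_of_false hv.ne fun h => hi ⟨_, h.symm⟩,
        iff_of_true rfl hi⟩
  choose τ hτ hτv hτB using ex
  let t : Quot (Glued e) → U := Quot.lift τ fun x y ⟨v, hx, hy, h1, h2⟩ =>
    ((hτv x v hx).2 h1).trans ((hτv y v hy).2 h2).symm
  have hbag : ∀ B q, q ∈ bag T t B ↔ ∃ i, q = Quot.mk _ ⟨B, i⟩ := by
    intro B q
    constructor
    · obtain ⟨⟨C, j⟩, rfl⟩ := Quot.exists_rep q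
      rintro (h | h)
      · change τ ⟨C, j⟩ = B.1 at h
        rcases hτ ⟨C, j⟩ with h' | h'
        · obtain rfl : C = B := Subtype.ext (h'.symm.trans h)
          exact ⟨j, rfl⟩
        · rw [h] at h'
          exact absurd B.2 (hT.not_isBlockVertex_of_adj C.2 h')
      · change T.Adj B.1 (τ ⟨C, j⟩) at h
        have hn := hT.not_isBlockVertex_of_adj B.2 h
        have h' := (hτ ⟨C, j⟩).resolve_left fun h' => hn (h'.symm ▸ C.2)
        exact ⟨e B ⟨_, h⟩, Quot.sound ⟨_, h', h, (hτv _ _ h').1 rfl, rfl⟩⟩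
    · rintro ⟨i, rfl⟩
      exact hτ ⟨B, i⟩
  refine ⟨t, fun u => ?_, fun x y => ?_⟩
  · by_cases hu : IsBlockVertex T u
    · have himage : {q | t q = u} =
          (fun i => Quot.mk (Glued e) ⟨⟨u, hu⟩, i⟩) '' (Set.range (e ⟨u, hu⟩))ᶜ := by
        ext q
        constructor
        · intro hq
          obtain ⟨i, rfl⟩ := (hbag ⟨u, hu⟩ q).1 (.inl hq)
          exact ⟨i, (hτB ⟨⟨u, hu⟩, i⟩).1 hq, rfl⟩
        · rintro ⟨i, hi, rfl⟩
          exact (hτB ⟨⟨u, hu⟩, i⟩).2 hi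
      rw [himage, Set.InjOn.ncard_image, Set.ncard_compl, ← Set.image_univ,
        Set.ncard_image_of_injective _ (e ⟨u, hu⟩).injective, Set.ncard_univ, Nat.card_fin,
        Nat.card_coe_set_eq, Nat.add_sub_cancel]
      intro i hi j _ hij
      rcases (mk_eq_mk_iff_glued e _ _).1 hij with h | ⟨v, hx, -, h, -⟩
      · simpa using h
      · exact absurd ⟨_, h.symm⟩ hi
    · rw [hT.weight_eq_one u hu]
      obtain ⟨B, -, hB, -⟩ := exists_adj_ne_of_not_isBlockVertex hu
      refine Set.ncard_eq_one.2
        ⟨Quot.mk _ ⟨⟨B, hT.isBlockVertex_of_adj hu hB⟩, e _ ⟨u, hB.symm⟩⟩, ?_⟩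
      ext q
      constructor
      · obtain ⟨⟨C, j⟩, rfl⟩ := Quot.exists_rep q
        intro (h : τ ⟨C, j⟩ = u)
        have hC := (hτ ⟨C, j⟩).resolve_left fun h' => hu (h ▸ h'.symm ▸ C.2)
        rw [h] at hC
        exact Quot.sound ⟨u, hC, hB.symm, (hτv _ _ hC).1 h, rfl⟩
      · rintro rfl
        exact (hτv _ _ hB.symm).2 rfl
  · simp only [hbag]
    constructor
    · rintro ⟨hne, B, i, j, hi, hj⟩
      exact ⟨hne, B, ⟨i, hi⟩, ⟨j, hj⟩⟩
    · rintro ⟨hne, B, ⟨i, hi⟩, ⟨j, hj⟩⟩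
      exact ⟨hne, B, i, j, hi, hj⟩

end Glued

/-! ### The bijection of isomorphism classes. -/

section Correspondence

theorem WeightedIso.symm {U U' : Type*} {T : SimpleGraph U} {w : U → ℕ} {T' : SimpleGraph U'}
    {w' : U' → ℕ} (h : WeightedIso T w T' w') : WeightedIso T' w' T w := by
  obtain ⟨f, hf⟩ := h
  exact ⟨f.symm, fun v => by rw [← hf, f.apply_symm_apply]⟩

theorem WeightedIso.trans {U U' U'' : Type*} {T : SimpleGraph U} {w : U → ℕ} {T' : SimpleGraph U'}
    {w' : U' → ℕ} {T'' : SimpleGraph U''} {w'' : U'' → ℕ} (h : WeightedIso T w T' w')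
    (h' : WeightedIso T' w' T'' w'') : WeightedIso T w T'' w'' := by
  obtain ⟨f, hf⟩ := h
  obtain ⟨g, hg⟩ := h'
  exact ⟨f.trans g, fun v => (hg (f v)).trans (hf v)⟩

theorem weightedIso_blockTree_iff {V U : Type*} [Finite V] {G : SimpleGraph V}
    {T : SimpleGraph U} {w : U → ℕ} (hG : G.Connected) (hB : IsBlockGraph G)
    (hT : IsAdmissible T w) :
    WeightedIso (blockTree G) (blockTreeWeight G) T w ↔ ∃ t, Represents G T w t := by
  constructor
  · intro h
    obtain ⟨t, ht⟩ := exists_represents_blockTree hG fun B hBl x hx y hy hxy =>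
      hB.adj_of_isNonseparable hBl.isNonseparable hx hy hxy
    exact ht.of_weightedIso hT.isTree.1 h
  · rintro ⟨t, ht⟩
    exact ht.weightedIso hT

/-- The disjoint union of sets of size `w u` is numbered by `finSigmaFinEquiv`, and adjacency is
defined by the bags. No condition on `(T, w)` is needed. -/
theorem exists_represents {m : ℕ} (T : SimpleGraph (Fin m)) (w : Fin m → ℕ) :
    ∃ (G : SimpleGraph (Fin (∑ u, w u))) (t : Fin (∑ u, w u) → Fin m), Represents G T w t := by
  let t : Fin (∑ u, w u) → Fin m := fun k => (finSigmaFinEquiv.symm k).1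
  refine ⟨{ Adj := fun x y => x ≠ y ∧ ∃ B, x ∈ bag T t B ∧ y ∈ bag T t B
            symm := ⟨fun _ _ ⟨h, B, hx, hy⟩ => ⟨h.symm, B, hy, hx⟩⟩
            loopless := ⟨fun _ h => h.1 rfl⟩ }, t, fun u => ?_, fun _ _ => Iff.rfl⟩
  have h : {k // t k = u} ≃ Fin (w u) :=
    (finSigmaFinEquiv.symm.subtypeEquiv fun _ => Iff.rfl).trans
      (Equiv.sigmaSubtype (β := fun u => Fin (w u)) u)
  exact (Nat.card_congr h).trans (Nat.card_fin _)

theorem isWeightedBlockTree_iff {m : ℕ} {T : SimpleGraph (Fin m)} {w : Fin m → ℕ} :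
    IsWeightedBlockTree T w ↔ IsAdmissible T w := by
  constructor
  · rintro ⟨-, k, H, hH, h⟩
    exact (isAdmissible_blockTree hH).of_weightedIso h
  · intro h
    obtain ⟨G, t, ht⟩ := exists_represents T w
    exact ⟨h.isTree, _, G, ht.connected h, ht.weightedIso h⟩

variable {n : ℕ}

theorem WeightedBlockTree.isAdmissible (T : WeightedBlockTree n) :
    IsAdmissible T.tree T.weight :=
  isWeightedBlockTree_iff.1 T.isWeightedBlockTree

theorem ConnectedBlockGraph.weightedIso_iff (G : ConnectedBlockGraph n) (T : WeightedBlockTree n) :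
    WeightedIso (blockTree G.graph) (blockTreeWeight G.graph) T.tree T.weight ↔
      ∃ t, Represents G.graph T.tree T.weight t :=
  weightedIso_blockTree_iff G.connected G.isBlockGraph T.isAdmissible

theorem ConnectedBlockGraph.exists_weightedBlockTree (G : ConnectedBlockGraph n) :
    ∃ T : WeightedBlockTree n,
      WeightedIso (blockTree G.graph) (blockTreeWeight G.graph) T.tree T.weight := by
  let φ := Finite.equivFin (BlockTreeVertex G.graph)
  have hiso : WeightedIso (blockTree G.graph) (blockTreeWeight G.graph)
      ((blockTree G.graph).map φ.toEmbedding) (blockTreeWeight G.graph ∘ φ.symm) :=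
    ⟨SimpleGraph.Iso.map φ _, fun v => congrArg _ (φ.symm_apply_apply v)⟩
  have hadm := (isAdmissible_blockTree G.connected).of_weightedIso hiso
  obtain ⟨t, ht⟩ := (weightedIso_blockTree_iff G.connected G.isBlockGraph hadm).1 hiso
  exact ⟨⟨_, _, _, isWeightedBlockTree_iff.2 hadm, by rw [← ht.card_eq, Nat.card_fin]⟩, hiso⟩

theorem WeightedBlockTree.exists_connectedBlockGraph (T : WeightedBlockTree n) :
    ∃ G : ConnectedBlockGraph n,
      WeightedIso (blockTree G.graph) (blockTreeWeight G.graph) T.tree T.weight := by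
  have hT := T.isAdmissible
  obtain ⟨m, T, w, h, rfl⟩ := T
  obtain ⟨G, t, ht⟩ := exists_represents T w
  exact ⟨⟨G, ht.connected hT, ht.isBlockGraph hT⟩, ht.weightedIso hT⟩

theorem exists_equiv_classes (n : ℕ) :
    ∃ Φ : ConnectedBlockGraphClass n ≃ WeightedBlockTreeClass n,
      ∀ (G : ConnectedBlockGraph n) (T : WeightedBlockTree n),
        Φ (Quotient.mk _ G) = Quotient.mk _ T ↔
          WeightedIso (blockTree G.graph) (blockTreeWeight G.graph) T.tree T.weight := by
  choose τ hτ using ConnectedBlockGraph.exists_weightedBlockTree (n := n)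
  have key : ∀ (G : ConnectedBlockGraph n) (T : WeightedBlockTree n),
      (Quotient.mk _ (τ G) : WeightedBlockTreeClass n) = Quotient.mk _ T ↔
        WeightedIso (blockTree G.graph) (blockTreeWeight G.graph) T.tree T.weight := by
    intro G T
    rw [Quotient.eq]
    exact ⟨fun h => (hτ G).trans h, fun h => (hτ G).symm.trans h⟩
  let F : ConnectedBlockGraphClass n → WeightedBlockTreeClass n :=
    Quotient.lift (fun G => Quotient.mk _ (τ G)) fun G G' ⟨f⟩ => by
      rw [key, ConnectedBlockGraph.weightedIso_iff]
      obtain ⟨t, ht⟩ := (G'.weightedIso_iff (τ G')).1 (hτ G')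
      exact ⟨_, ht.comp_iso f⟩
  have hF : Function.Bijective F := by
    constructor
    · intro a b
      induction a using Quotient.inductionOn with | _ G
      induction b using Quotient.inductionOn with | _ G'
      intro h
      obtain ⟨t, ht⟩ := (G.weightedIso_iff _).1 ((key G (τ G')).1 h)
      obtain ⟨t', ht'⟩ := (G'.weightedIso_iff _).1 (hτ G')
      exact Quotient.sound (ht.nonempty_iso ht')
    · intro b
      induction b using Quotient.inductionOn with | _ T
      obtain ⟨G, hG⟩ := T.exists_connectedBlockGraph
      exact ⟨Quotient.mk _ G, (key G T).2 hG⟩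
  exact ⟨Equiv.ofBijective F hF, key⟩

end Correspondence

end BlockGraphs

theorem mainTheorem2 :
    -- the one-to-one correspondence, up to isomorphism, and its inverse
    (∀ n : ℕ, ∃ Φ : BlockGraphs.ConnectedBlockGraphClass n ≃ BlockGraphs.WeightedBlockTreeClass n,
      (∀ (G : BlockGraphs.ConnectedBlockGraph n) (T : BlockGraphs.WeightedBlockTree n),
        Φ (Quotient.mk _ G) = Quotient.mk _ T ↔
          BlockGraphs.WeightedIso (BlockGraphs.blockTree G.graph)
            (BlockGraphs.blockTreeWeight G.graph) T.tree T.weight) ∧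
      (∀ (T : BlockGraphs.WeightedBlockTree n)
        (e : BlockGraphs.GluingChoice T.tree T.weight) (G : BlockGraphs.ConnectedBlockGraph n),
        Φ.symm (Quotient.mk _ T) = Quotient.mk _ G ↔
          Nonempty (G.graph ≃g BlockGraphs.gluedGraph e))) ∧
    -- which weighted trees are weighted block trees
    (∀ (m : ℕ) (T : SimpleGraph (Fin m)) (w : Fin m → ℕ),
      BlockGraphs.IsWeightedBlockTree T w ↔
        T.IsTree ∧
        (∀ l l' : Fin m, BlockGraphs.IsLeaf T l → BlockGraphs.IsLeaf T l' → Even (T.dist l l')) ∧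
        (∀ v : Fin m, ¬ BlockGraphs.IsBlockVertex T v → w v = 1) ∧
        (∀ l : Fin m, BlockGraphs.IsLeaf T l → 1 ≤ w l)) := by
  refine ⟨fun n => ?_, fun m T w =>
    BlockGraphs.isWeightedBlockTree_iff.trans BlockGraphs.isAdmissible_iff⟩
  obtain ⟨Φ, hΦ⟩ := BlockGraphs.exists_equiv_classes n
  refine ⟨Φ, hΦ, fun T e G => ?_⟩
  rw [Equiv.symm_apply_eq, eq_comm, hΦ, G.weightedIso_iff]
  obtain ⟨s, hs⟩ := BlockGraphs.exists_represents_gluedGraph T.isAdmissible e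
  -- Independence of the choice `e` comes from uniqueness of the represented graph.
  exact ⟨fun ⟨t, ht⟩ => ht.nonempty_iso hs, fun ⟨f⟩ => ⟨_, hs.comp_iso f⟩⟩
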